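/- Let $n\ge 1$ and $k\ge 0$ be integers. A well-labelled positive path of size $n$ is a pair $(\mathbf p,\sigma)$ consisting of a word $\mathbf p=p_1p_2\cdots p_{n-1}$ on the alphabet $\{-1,0,+1\}$ such that $\sum_{i=1}^{j}p_i\ge 0$ for all $j=1,\dots,n-1$, and a permutation $\sigma=\sigma_1\sigma_2\cdots\sigma_n$ of $\{1,\dots,n\}$ such that, for every $i$, $p_i=-1$ implies $\sigma_i<\sigma_{i+1}$ and $p_i=+1$ implies $\sigma_i>\sigma_{i+1}$. A horizontal step of $(\mathbf p,\sigma)$ is a letter $0$ of $\mathbf p$. For an integer $m\ge 1$ write $m!!=m(m-2)(m-4)\cdots$, the product ending in $1$ or $2$, and $0!!=(-1)!!=1$. Then the number of well-labelled positive paths of size $n$ having exactly $k$ horizontal steps is $$\binom{n}{k}\binom{n-1}{k}\,k!\,\big[(n-k-1)!!\big]^2\quad\text{if } n-k \text{ is even},$$ $$\binom{n}{k}\binom{n-1}{k}\,k!\,(n-k)!!\,(n-k-2)!!\quad\text{otherwise}.$$ (For $k\ge n$ the factor $\binom{n-1}{k}$ is zero, and the formulas are read as $0$.) -/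

import Mathlib

open scoped Nat

/-- The pair `(p, σ)`, where `p` is a word of length `n - 1` on the alphabet `{-1, 0, 1}` and `σ` is
a permutation of `n` ordered labels, is a well-labelled path of size `n`: a letter `-1` forces
an ascent of `σ` at its position and a letter `1` forces a descent. Positions are numbered
from `0`. -/
def IsWellLabelled {n : ℕ} (p : Fin (n - 1) → SignType) (σ : Equiv.Perm (Fin n)) : Prop :=
  ∀ i : Fin (n - 1),
    (p i = -1 → σ ⟨i, by omega⟩ < σ ⟨i + 1, by omega⟩) ∧
    (p i = 1 → σ ⟨i, by omega⟩ > σ ⟨i + 1, by omega⟩)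

/-- All sums of a nonempty prefix of the word `p` are nonnegative integers. -/
def IsPositiveWord {m : ℕ} (p : Fin m → SignType) : Prop :=
  ∀ j : Fin m, 0 ≤ ∑ i ∈ Finset.Iic j, (p i : ℤ)

/-- The number of letters `0` of the word `p`. -/
def horizontalSteps {m : ℕ} (p : Fin m → SignType) : ℕ :=
  (Finset.univ.filter fun i => p i = 0).card

/-- The set of well-labelled positive paths of size `n` with `k` horizontal steps. -/
def positivePaths (n k : ℕ) : Set ((Fin (n - 1) → SignType) × Equiv.Perm (Fin n)) :=
  {P | IsWellLabelled P.1 P.2 ∧ IsPositiveWord P.1 ∧ horizontalSteps P.1 = k}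

/-! Mark horizontal steps by a variable `u` and let `P_n(u)` (`sizePoly`) count the well-labelled
positive paths of size `n`, with `P_0 = 1`. The closed form comes from a quadratic identity,
obtained by counting pairs (labelled word, cut) in two ways. A word of length `m`, positive or not,
has exactly two cuts (`card_isCut`): at the first visit to its minimum and just after the last one.
On the other hand, a cut leaves a reversed positive path, a letter `±1` and a positive path. Summing
over the two signs removes the constraint on the labels at the junction, so that the labels are
shuffled freely (`numLabellings_joinWord_add`). Words without the positivity condition are easy to
count (`sum_wordWeight`), and hence `∑ binom(m+1, j) P_j P_{m+1-j} = 2 (m+1)! (1+u)^m`. For the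
exponential generating function `A` this reads `A² = (1+(1-u)t)/(1-(1+u)t)`. Differentiating gives a
linear differential equation, that is, a three-term recurrence for `P_n` (`sizePoly_succ_succ`),
which the closed form also satisfies. -/

section

open Finset Equiv

/-! ### Words joined by a letter -/

/-- The order relation between consecutive labels `x`, `y` that a letter `s` forces. -/
def Compat {α : Type*} [LT α] (s : SignType) (x y : α) : Prop :=
  (s = -1 → x < y) ∧ (s = 1 → y < x)

theorem isWellLabelled_iff {m : ℕ} (w : Fin m → SignType) (σ : Perm (Fin (m + 1))) :
    IsWellLabelled (n := m + 1) w σ ↔ ∀ i : Fin m, Compat (w i) (σ i.castSucc) (σ i.succ) :=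
  Iff.rfl

/-- Two words joined by a letter. -/
def joinWord {a b : ℕ} (l : Fin a → SignType) (s : SignType) (r : Fin b → SignType) :
    Fin (a + 1 + b) → SignType :=
  Fin.append (Fin.snoc (α := fun _ => SignType) l s) r

@[simp] theorem joinWord_castSucc {a b : ℕ} (l : Fin a → SignType) (s : SignType)
    (r : Fin b → SignType) (i : Fin a) : joinWord l s r (Fin.castAdd b i.castSucc) = l i := by
  simp [joinWord]

@[simp] theorem joinWord_last {a b : ℕ} (l : Fin a → SignType) (s : SignType)
    (r : Fin b → SignType) : joinWord l s r (Fin.castAdd b (Fin.last a)) = s := by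
  simp [joinWord]

@[simp] theorem joinWord_natAdd {a b : ℕ} (l : Fin a → SignType) (s : SignType)
    (r : Fin b → SignType) (i : Fin b) : joinWord l s r (Fin.natAdd (a + 1) i) = r i := by
  simp [joinWord]

theorem isWellLabelled_joinWord_iff {a b : ℕ} (l : Fin a → SignType) (s : SignType)
    (r : Fin b → SignType) (σ : Perm (Fin (a + 1 + (b + 1)))) :
    IsWellLabelled (n := a + 1 + (b + 1)) (joinWord l s r) σ ↔
      (∀ i : Fin a, Compat (l i) (σ (Fin.castAdd (b + 1) i.castSucc))
        (σ (Fin.castAdd (b + 1) i.succ))) ∧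
      Compat s (σ (Fin.castAdd (b + 1) (Fin.last a))) (σ (Fin.natAdd (a + 1) 0)) ∧
      ∀ i : Fin b, Compat (r i) (σ (Fin.natAdd (a + 1) i.castSucc))
        (σ (Fin.natAdd (a + 1) i.succ)) := by
  have key := isWellLabelled_iff (m := a + 1 + b) (joinWord l s r) σ
  refine key.trans ⟨fun h => ⟨fun i => ?_, ?_, fun i => ?_⟩, fun ⟨h1, h2, h3⟩ i => ?_⟩
  · have := h (Fin.castAdd b i.castSucc)
    rw [joinWord_castSucc] at this
    exact this
  · have := h (Fin.castAdd b (Fin.last a))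
    rw [joinWord_last] at this
    exact this
  · have := h (Fin.natAdd (a + 1) i)
    rw [joinWord_natAdd] at this
    exact this
  · induction i using Fin.addCases with
    | left i =>
      induction i using Fin.lastCases with
      | last =>
        rw [joinWord_last]
        exact h2
      | cast i =>
        rw [joinWord_castSucc]
        exact h1 i
    | right i =>
      rw [joinWord_natAdd]
      exact h3 i

/-! ### Shuffles of permutations -/

theorem card_compl_of_card {A B : ℕ} (S : {S : Finset (Fin (A + B)) // #S = A}) :
    #(S.1ᶜ) = B := by
  rw [card_compl, S.2, Fintype.card_fin, Nat.add_sub_cancel_left]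

/-- The permutation obtained by shuffling two permutations: the first `A` values form
the set `S`. -/
noncomputable def shufflePerm {A B : ℕ} (S : {S : Finset (Fin (A + B)) // #S = A})
    (α : Perm (Fin A)) (β : Perm (Fin B)) : Perm (Fin (A + B)) :=
  Equiv.ofBijective
    (Fin.append (fun i => S.1.orderEmbOfFin S.2 (α i))
      (fun i => S.1ᶜ.orderEmbOfFin (card_compl_of_card S) (β i))) <| by
    refine Finite.injective_iff_bijective.1 ?_
    rw [Fin.append_injective_iff]
    refine ⟨(S.1.orderEmbOfFin S.2).injective.comp α.injective,
      (S.1ᶜ.orderEmbOfFin (card_compl_of_card S)).injective.comp β.injective, fun i j h => ?_⟩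
    have h1 := S.1.orderEmbOfFin_mem S.2 (α i)
    have h2 := S.1ᶜ.orderEmbOfFin_mem (card_compl_of_card S) (β j)
    rw [← h] at h2
    exact (mem_compl.1 h2) h1

theorem shufflePerm_castAdd {A B : ℕ} (S : {S : Finset (Fin (A + B)) // #S = A})
    (α : Perm (Fin A)) (β : Perm (Fin B)) (i : Fin A) :
    shufflePerm S α β (Fin.castAdd B i) = S.1.orderEmbOfFin S.2 (α i) := by
  simp [shufflePerm]

theorem shufflePerm_natAdd {A B : ℕ} (S : {S : Finset (Fin (A + B)) // #S = A})
    (α : Perm (Fin A)) (β : Perm (Fin B)) (i : Fin B) :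
    shufflePerm S α β (Fin.natAdd A i) =
      S.1ᶜ.orderEmbOfFin (card_compl_of_card S) (β i) := by
  simp [shufflePerm]

/-- The set `S` is recovered as the set of the first `A` values, and the order embeddings then
determine both permutations. Surjectivity follows by comparing cardinalities. -/
theorem shufflePerm_bijective (A B : ℕ) :
    Function.Bijective (fun x : {S : Finset (Fin (A + B)) // #S = A} ×
      Perm (Fin A) × Perm (Fin B) => shufflePerm x.1 x.2.1 x.2.2) := by
  rw [Fintype.bijective_iff_injective_and_card]
  constructor
  · rintro ⟨S, α, β⟩ ⟨S', α', β'⟩ h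
    have hl : ∀ i, S.1.orderEmbOfFin S.2 (α i) = S'.1.orderEmbOfFin S'.2 (α' i) := fun i => by
      rw [← shufflePerm_castAdd S α β, ← shufflePerm_castAdd S' α' β']
      exact DFunLike.congr_fun h _
    have hr : ∀ i, S.1ᶜ.orderEmbOfFin (card_compl_of_card S) (β i) =
        S'.1ᶜ.orderEmbOfFin (card_compl_of_card S') (β' i) := fun i => by
      rw [← shufflePerm_natAdd S α β, ← shufflePerm_natAdd S' α' β']
      exact DFunLike.congr_fun h _
    have hS : S = S' := by
      apply Subtype.ext
      apply eq_of_subset_of_card_le _ (by rw [S.2, S'.2])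
      intro x hx
      obtain ⟨i, rfl⟩ : ∃ i, S.1.orderEmbOfFin S.2 i = x := by
        have := S.1.range_orderEmbOfFin S.2
        rw [Set.ext_iff] at this
        exact (this x).2 hx
      have := hl (α.symm i)
      rw [apply_symm_apply] at this
      rw [this]
      exact S'.1.orderEmbOfFin_mem S'.2 _
    subst hS
    have hα : α = α' := Equiv.ext fun i => (S.1.orderEmbOfFin S.2).injective (hl i)
    have hβ : β = β' := Equiv.ext fun i => (S.1ᶜ.orderEmbOfFin _).injective (hr i)
    rw [hα, hβ]
  · rw [Fintype.card_prod, Fintype.card_prod, Fintype.card_finset_len, Fintype.card_perm,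
      Fintype.card_perm, Fintype.card_perm, Fintype.card_fin, Fintype.card_fin, Fintype.card_fin,
      ← mul_assoc, Nat.choose_symm_add, Nat.add_choose_mul_factorial_mul_factorial]

/-! ### Counting the labellings of a word -/

open scoped Classical in
/-- The number of permutations that label the word `w` well. -/
noncomputable def numLabellings {m : ℕ} (w : Fin m → SignType) : ℕ :=
  #{σ : Perm (Fin (m + 1)) | IsWellLabelled (n := m + 1) w σ}

theorem compat_zero {α : Type*} [LT α] (x y : α) : Compat 0 x y :=
  ⟨fun h => absurd h (by decide), fun h => absurd h (by decide)⟩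

theorem compat_one_or_neg_one {α : Type*} [LinearOrder α] {x y : α} (hne : x ≠ y) :
    Compat 1 x y ∨ Compat (-1) x y := by
  rcases lt_or_gt_of_ne hne with h | h
  · exact Or.inr ⟨fun _ => h, fun h => absurd h (by decide)⟩
  · exact Or.inl ⟨fun h => absurd h (by decide), fun _ => h⟩

theorem compat_map_iff {α β : Type*} [LinearOrder α] [LinearOrder β] (f : α ↪o β) (s : SignType)
    (x y : α) : Compat s (f x) (f y) ↔ Compat s x y := by
  simp [Compat]

/-- The letter `0` imposes nothing at the junction, and the other constraints only see relative
order within each half, which a shuffle preserves. -/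
theorem numLabellings_joinWord_zero {a b : ℕ} (l : Fin a → SignType) (r : Fin b → SignType) :
    numLabellings (joinWord l 0 r) =
      (a + 1 + (b + 1)).choose (a + 1) * (numLabellings l * numLabellings r) := by
  classical
  have hb := shufflePerm_bijective (a + 1) (b + 1)
  have h1 : numLabellings (joinWord l 0 r) =
      #((univ : Finset {S : Finset (Fin (a + 1 + (b + 1))) // #S = a + 1}) ×ˢ
        ((univ.filter fun σ : Perm (Fin (a + 1)) => IsWellLabelled (n := a + 1) l σ) ×ˢ
        (univ.filter fun σ : Perm (Fin (b + 1)) => IsWellLabelled (n := b + 1) r σ))) := by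
    symm
    refine card_bijective _ hb fun x => ?_
    obtain ⟨S, α, β⟩ := x
    simp only [mem_product, mem_filter, mem_univ, true_and]
    rw [isWellLabelled_iff, isWellLabelled_iff]
    refine Iff.trans ?_ (isWellLabelled_joinWord_iff l 0 r (shufflePerm S α β)).symm
    simp only [shufflePerm_castAdd, shufflePerm_natAdd, compat_map_iff]
    simp [Compat]
  rw [h1, card_product, card_product, card_univ, Fintype.card_finset_len, Fintype.card_fin]
  rfl

/-- The two labels at the junction are distinct, so exactly one of the letters `1` and `-1` is
compatible with them: together they amount to the unconstrained letter `0`. -/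
theorem numLabellings_joinWord_add {a b : ℕ} (l : Fin a → SignType) (r : Fin b → SignType) :
    numLabellings (joinWord l 1 r) + numLabellings (joinWord l (-1) r) =
      (a + 1 + (b + 1)).choose (a + 1) * (numLabellings l * numLabellings r) := by
  classical
  rw [← numLabellings_joinWord_zero]
  unfold numLabellings
  rw [← card_union_of_disjoint]
  · congr 1
    ext σ
    simp only [mem_union, mem_filter, mem_univ, true_and]
    have hs := fun s => isWellLabelled_joinWord_iff l s r σ
    refine (or_congr (hs 1) (hs (-1))).trans (Iff.trans ?_ (hs 0).symm)
    have hne : Fin.castAdd (b + 1) (Fin.last a) ≠ Fin.natAdd (a + 1) (0 : Fin (b + 1)) := by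
      intro h
      have := congrArg Fin.val h
      simp at this
    have key : ∀ {x y : Fin (a + 1 + (b + 1))} (P Q : Prop), x ≠ y →
        (P ∧ Compat 1 x y ∧ Q ∨ P ∧ Compat (-1) x y ∧ Q ↔ P ∧ Compat 0 x y ∧ Q) := by
      intro x y P Q h
      have h1 := compat_one_or_neg_one h
      have h0 := compat_zero x y
      tauto
    exact key _ _ (σ.injective.ne hne)
  · rw [disjoint_left]
    intro σ h h'
    have h1 := ((isWellLabelled_joinWord_iff l 1 r σ).1 (mem_filter.1 h).2).2.1.2 rfl
    have h2 := ((isWellLabelled_joinWord_iff l (-1) r σ).1 (mem_filter.1 h').2).2.1.1 rfl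
    exact lt_asymm h1 h2

/-- The word read backwards, with opposite letters. -/
def revWord {m : ℕ} (w : Fin m → SignType) : Fin m → SignType := fun i => -w i.rev

theorem revWord_involutive (m : ℕ) : Function.Involutive (revWord (m := m)) := by
  intro w
  funext i
  simp [revWord]

/-- Reading a permutation backwards exchanges ascents and descents, which the change of sign of the
letters compensates. -/
theorem numLabellings_revWord {m : ℕ} (w : Fin m → SignType) :
    numLabellings (revWord w) = numLabellings w := by
  classical
  symm
  refine card_bijective (fun σ : Perm (Fin (m + 1)) => Fin.revPerm.trans σ)
    (Function.Involutive.bijective fun σ => by ext; simp) fun σ => ?_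
  simp only [mem_filter, mem_univ, true_and]
  rw [isWellLabelled_iff, isWellLabelled_iff, ← Fin.revPerm.forall_congr_right]
  refine forall_congr' fun i => ?_
  simp only [revWord, Compat, Fin.revPerm_apply, Equiv.trans_apply, Fin.rev_castSucc, Fin.rev_succ]
  rw [and_comm]
  have h1 : ∀ s : SignType, (-s = -1 ↔ s = 1) ∧ (-s = 1 ↔ s = -1) := by decide
  rw [(h1 _).1, (h1 _).2]

open Polynomial in
/-- The monomial counting the labellings of `w`, marked by its number of zeros. -/
noncomputable def wordWeight {m : ℕ} (w : Fin m → SignType) : ℚ[X] :=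
  (numLabellings w : ℚ[X]) * X ^ horizontalSteps w

theorem horizontalSteps_revWord {m : ℕ} (w : Fin m → SignType) :
    horizontalSteps (revWord w) = horizontalSteps w := by
  refine card_bijective Fin.revPerm Fin.revPerm.bijective fun i => ?_
  have : ∀ s : SignType, -s = 0 ↔ s = 0 := by decide
  simp [revWord, this]

theorem wordWeight_revWord {m : ℕ} (w : Fin m → SignType) :
    wordWeight (revWord w) = wordWeight w := by
  rw [wordWeight, numLabellings_revWord, horizontalSteps_revWord, wordWeight]

theorem horizontalSteps_joinWord {a b : ℕ} (l : Fin a → SignType) {s : SignType} (hs : s ≠ 0)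
    (r : Fin b → SignType) :
    horizontalSteps (joinWord l s r) = horizontalSteps l + horizontalSteps r := by
  simp only [horizontalSteps, card_filter]
  rw [Fin.sum_univ_add, Fin.sum_univ_castSucc]
  simp [hs]

open Polynomial in
theorem wordWeight_joinWord_add {a b : ℕ} (l : Fin a → SignType) (r : Fin b → SignType) :
    wordWeight (joinWord l 1 r) + wordWeight (joinWord l (-1) r) =
      ((a + 1 + (b + 1)).choose (a + 1) : ℚ[X]) * (wordWeight l * wordWeight r) := by
  have h := congrArg (Nat.cast : ℕ → ℚ[X]) (numLabellings_joinWord_add l r)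
  push_cast at h
  simp only [wordWeight]
  rw [horizontalSteps_joinWord l (by decide), horizontalSteps_joinWord l (by decide), ← add_mul, h,
    pow_add]
  ring

-- For a fixed permutation the letters can be chosen independently: each position admits `0`, of
-- weight `X`, and exactly one of `±1`, of weight `1`.
open Polynomial in
theorem sum_wordWeight (m : ℕ) :
    ∑ w : Fin m → SignType, wordWeight w = ((m + 1)! : ℚ[X]) * (1 + X) ^ m := by
  classical
  have h1 : ∀ w : Fin m → SignType, wordWeight w = ∑ σ : Perm (Fin (m + 1)),
      ∏ i, if Compat (w i) (σ i.castSucc) (σ i.succ) then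
        (if w i = 0 then (X : ℚ[X]) else 1) else 0 := by
    intro w
    rw [wordWeight, numLabellings, card_filter, Nat.cast_sum, sum_mul]
    refine sum_congr rfl fun σ _ => ?_
    rw [isWellLabelled_iff]
    split_ifs with h
    · simp only [h, if_true]
      rw [prod_ite]
      simp [horizontalSteps]
    · push Not at h
      obtain ⟨i, hi⟩ := h
      rw [prod_eq_zero (mem_univ i) (by rw [if_neg hi])]
      simp
  simp_rw [h1]
  rw [sum_comm]
  have h2 : ∀ σ : Perm (Fin (m + 1)), ∑ w : Fin m → SignType,
      (∏ i, if Compat (w i) (σ i.castSucc) (σ i.succ) then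
        (if w i = 0 then (X : ℚ[X]) else 1) else 0) = (1 + X) ^ m := by
    intro σ
    have := Finset.prod_univ_sum (fun _ : Fin m => (univ : Finset SignType))
      (fun i s => if Compat s (σ i.castSucc) (σ i.succ) then
        (if s = 0 then (X : ℚ[X]) else 1) else 0)
    rw [Fintype.piFinset_univ] at this
    rw [← this]
    rw [prod_eq_pow_card (b := 1 + X), card_univ, Fintype.card_fin]
    intro i _
    have hne : σ i.castSucc ≠ σ i.succ := fun h =>
      (Fin.castSucc_lt_succ (i := i)).ne (σ.injective h)
    have hu : (univ : Finset SignType) = {0, -1, 1} := rfl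
    rw [hu, sum_insert (by decide), sum_insert (by decide), sum_singleton]
    have d1 : (0 : SignType) ≠ -1 := by decide
    have d2 : (0 : SignType) ≠ 1 := by decide
    have d3 : (-1 : SignType) ≠ 1 := by decide
    rcases lt_or_gt_of_ne hne with h | h
    · simp [Compat, d1, d2, d3, d1.symm, d3.symm, h, h.not_gt, add_comm]
    · simp [Compat, d1, d2, d3, d2.symm, d3.symm, h, h.not_gt, add_comm]
  simp_rw [h2]
  rw [sum_const, card_univ, Fintype.card_perm, Fintype.card_fin, nsmul_eq_mul]

/-! ### The two cuts of a walk -/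

/-- `j` cuts the walk `h` with vertices `0, …, m`: the part before `j` stays above its last vertex,
the part from `j` on stays above its first vertex, and the two parts are joined by a step that is
not horizontal. -/
def IsCut (h : ℕ → ℤ) (m j : ℕ) : Prop :=
  (∀ i < j, h (j - 1) ≤ h i) ∧ (∀ i, j ≤ i → i ≤ m → h j ≤ h i) ∧
    (0 < j → j ≤ m → h j ≠ h (j - 1))

-- With `f` and `l` the first and last positions of the minimum, the cuts are `f` and `l + 1`,
-- distinct because `f ≤ l`. Steps of size at most one are what make these two positions cuts.
open scoped Classical in
theorem card_isCut (h : ℕ → ℤ) (m : ℕ) (hstep : ∀ i < m, |h (i + 1) - h i| ≤ 1) :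
    #{j ∈ range (m + 2) | IsCut h m j} = 2 := by
  obtain ⟨c, hc, hmin⟩ := exists_min_image (range (m + 1)) h ⟨0, by simp⟩
  have hcm : c ≤ m := by simpa [Nat.lt_succ_iff] using hc
  have hmin' : ∀ i ≤ m, h c ≤ h i := fun i hi => hmin i (by simpa [Nat.lt_succ_iff] using hi)
  have hex : ∃ i, i ≤ m ∧ h i = h c := ⟨c, hcm, rfl⟩
  obtain ⟨f, ⟨hfm, hf⟩, hff⟩ : ∃ f, (f ≤ m ∧ h f = h c) ∧ ∀ i < f, h c < h i :=
    ⟨Nat.find hex, Nat.find_spec hex, fun i hi => by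
      have hi' := Nat.find_min hex hi
      have him : i ≤ m := hi.le.trans (Nat.find_spec hex).1
      exact lt_of_le_of_ne (hmin' i him) fun e => hi' ⟨him, e.symm⟩⟩
  have hne : ((range (m + 1)).filter fun i => h i = h c).Nonempty := 
    ⟨c, by simpa using hc⟩
  obtain ⟨l, ⟨hlm, hl⟩, hll⟩ : ∃ l, (l ≤ m ∧ h l = h c) ∧ ∀ i, l < i → i ≤ m → h c < h i := by
    have hmem := max'_mem _ hne
    rw [mem_filter, mem_range, Nat.lt_succ_iff] at hmem
    refine ⟨_, hmem, fun i hi him => lt_of_le_of_ne (hmin' i him) fun e => ?_⟩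
    have := le_max' ((range (m + 1)).filter fun i => h i = h c) i
      (by simp [him, e])
    omega
  have hfl : f ≤ l := by
    by_contra! hlt
    exact absurd (hff l hlt) (by rw [hl]; exact lt_irrefl _)
  have hset : ((range (m + 2)).filter fun j => IsCut h m j) = {f, l + 1} := by
    ext j
    simp only [mem_filter, mem_range, mem_insert, mem_singleton]
    constructor
    · rintro ⟨hj, h1, h2, h3⟩
      by_cases hj0 : j = 0
      · left
        subst hj0
        by_contra hne
        have := h2 f (Nat.zero_le _) hfm
        have := hff 0 (by omega)
        omega
      by_cases hjm : j = m + 1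
      · right
        subst hjm
        by_contra hne
        have h4 := h1 l (by omega)
        have h5 := hll m (by omega) le_rfl
        simp only [Nat.add_sub_cancel] at h4
        omega
      have h4 := h3 (by omega) (by omega)
      -- The lower end of the joining step is a global minimum: a descending step forces `j = f`, an
      -- ascending one `j - 1 = l`.
      rcases lt_or_gt_of_ne h4 with h5 | h5
      · left
        have hjc : h j = h c := by
          rcases lt_or_ge c j with hc' | hc'
          · have := h1 c hc'; have := hmin' j (by omega); omega
          · have := h2 c hc' hcm; have := hmin' j (by omega); omega
        rcases lt_trichotomy j f with h6 | h6 | h6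
        · have := hff j h6; omega
        · exact h6
        · have := h1 f h6; omega
      · right
        have hjc : h (j - 1) = h c := by
          rcases lt_or_ge c j with hc' | hc'
          · have := h1 c hc'; have := hmin' (j - 1) (by omega); omega
          · have := h2 c hc' hcm; have := hmin' (j - 1) (by omega); omega
        rcases lt_trichotomy (j - 1) l with h6 | h6 | h6
        · have := h2 l (by omega) hlm; omega
        · omega
        · have := hll (j - 1) h6 (by omega); omega
    · rintro (rfl | rfl)
      · refine ⟨by omega, fun i hi => ?_, fun i _ him => by rw [hf]; exact hmin' i him,
          fun h0 _ => ?_⟩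
        · have h1 := hff i hi
          have h2 := abs_le.1 (hstep (j - 1) (by omega))
          rw [Nat.sub_add_cancel (by omega)] at h2
          omega
        · have := hff (j - 1) (by omega)
          omega
      · refine ⟨by omega, fun i hi => ?_, fun i hi him => ?_, fun _ hm => ?_⟩
        · rw [Nat.add_sub_cancel, hl]
          exact hmin' i (by omega)
        · have h1 := hll i (by omega) him
          have h2 := abs_le.1 (hstep l (by omega))
          omega
        · have := hll (l + 1) (by omega) hm
          rw [Nat.add_sub_cancel]
          omega
  rw [hset, card_pair (by omega)]

/-! ### Heights, reversal and cuts of words -/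

/-- The height reached by the word `w` after `i` letters. -/
def height {m : ℕ} (w : Fin m → SignType) (i : ℕ) : ℤ :=
  ∑ l : Fin m, if l.1 < i then (w l : ℤ) else 0

theorem height_zero {m : ℕ} (w : Fin m → SignType) : height w 0 = 0 := by
  simp [height]

theorem height_succ {m : ℕ} (w : Fin m → SignType) (i : Fin m) :
    height w (i + 1) = height w i + w i := by
  have : ∀ l : Fin m, (if l.1 < i.1 + 1 then (w l : ℤ) else 0) =
      (if l.1 < i.1 then (w l : ℤ) else 0) + if l = i then (w l : ℤ) else 0 := by
    intro l
    rcases lt_trichotomy l i with h | h | h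
    · rw [if_pos (by omega), if_pos (by omega), if_neg h.ne, add_zero]
    · subst h; simp
    · rw [if_neg (by omega), if_neg (by omega), if_neg h.ne', add_zero]
  rw [height, height, sum_congr rfl fun l _ => this l, sum_add_distrib]
  simp

theorem isPositiveWord_iff_height {m : ℕ} (w : Fin m → SignType) :
    IsPositiveWord w ↔ ∀ i ≤ m, 0 ≤ height w i := by
  have key : ∀ j : Fin m, ∑ i ∈ Iic j, (w i : ℤ) = height w (j + 1) := by
    intro j
    rw [height, ← sum_filter]
    refine sum_congr ?_ fun _ _ => rfl
    ext i
    rw [mem_Iic, mem_filter, Fin.le_def, Nat.lt_succ_iff]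
    simp
  constructor
  · intro h i hi
    rcases Nat.eq_zero_or_pos i with rfl | h0
    · rw [height_zero]
    · have := h ⟨i - 1, by omega⟩
      rw [key] at this
      simpa [Nat.sub_add_cancel h0] using this
  · intro h j
    rw [key]
    exact h _ j.2

theorem abs_coe_signType_le_one (s : SignType) : |(s : ℤ)| ≤ 1 := by
  cases s <;> simp

theorem height_joinWord_left {a b : ℕ} (l : Fin a → SignType) (s : SignType)
    (r : Fin b → SignType) {i : ℕ} (hi : i ≤ a) : height (joinWord l s r) i = height l i := by
  simp only [height]
  rw [Fin.sum_univ_add, Fin.sum_univ_castSucc]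
  simp only [joinWord_castSucc, joinWord_last, joinWord_natAdd, Fin.val_castAdd,
    Fin.val_natAdd, Fin.val_castSucc, Fin.val_last]
  rw [if_neg (by omega), sum_eq_zero (s := univ (α := Fin b)) fun j _ => if_neg (by omega)]
  simp

theorem height_joinWord_right {a b : ℕ} (l : Fin a → SignType) (s : SignType)
    (r : Fin b → SignType) (i : ℕ) :
    height (joinWord l s r) (a + 1 + i) = height l a + s + height r i := by
  simp only [height]
  rw [Fin.sum_univ_add, Fin.sum_univ_castSucc]
  simp only [joinWord_castSucc, joinWord_last, joinWord_natAdd, Fin.val_castAdd,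
    Fin.val_natAdd, Fin.val_castSucc, Fin.val_last]
  rw [if_pos (by omega)]
  congr 1
  · congr 1
    exact sum_congr rfl fun j _ => by rw [if_pos (by omega), if_pos j.2]
  · exact sum_congr rfl fun j _ => by simp only [Nat.add_lt_add_iff_left]

theorem height_revWord {m : ℕ} (w : Fin m → SignType) {i : ℕ} (hi : i ≤ m) :
    height (revWord w) i = height w (m - i) - height w m := by
  have hneg : ∀ s : SignType, ((-s : SignType) : ℤ) = -(s : ℤ) := by decide
  have h1 : height (revWord w) i = ∑ l : Fin m, if l.rev.1 < i then (-(w l : ℤ)) else 0 := by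
    rw [height, ← Equiv.sum_comp Fin.revPerm]
    simp [revWord, hneg]
  rw [h1, height, height, ← sum_sub_distrib]
  refine sum_congr rfl fun l _ => ?_
  have := l.2
  rw [Fin.val_rev, if_pos l.2]
  split_ifs <;> omega

/-- The word never goes below its final height. -/
def IsRevPositiveWord {m : ℕ} (w : Fin m → SignType) : Prop :=
  ∀ i ≤ m, height w m ≤ height w i

theorem isPositiveWord_revWord_iff {m : ℕ} (w : Fin m → SignType) :
    IsPositiveWord (revWord w) ↔ IsRevPositiveWord w := by
  rw [isPositiveWord_iff_height]
  constructor
  · intro h i hi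
    have := h (m - i) (by omega)
    rw [height_revWord _ (by omega), Nat.sub_sub_self hi] at this
    omega
  · intro h i hi
    rw [height_revWord _ hi]
    have := h (m - i) (by omega)
    omega

theorem isCut_height_zero_iff {m : ℕ} (w : Fin m → SignType) :
    IsCut (height w) m 0 ↔ IsPositiveWord w := by
  rw [isPositiveWord_iff_height]
  simp [IsCut, height_zero]

theorem isCut_height_last_iff {m : ℕ} (w : Fin m → SignType) :
    IsCut (height w) m (m + 1) ↔ IsRevPositiveWord w := by
  simp only [IsCut, IsRevPositiveWord, Nat.lt_succ_iff, Nat.add_sub_cancel]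
  constructor
  · exact fun h => h.1
  · exact fun h => ⟨h, fun i _ _ => by omega, fun _ _ => by omega⟩

theorem isCut_height_joinWord_iff {a b : ℕ} (l : Fin a → SignType) (s : SignType)
    (r : Fin b → SignType) :
    IsCut (height (joinWord l s r)) (a + 1 + b) (a + 1) ↔
      IsRevPositiveWord l ∧ IsPositiveWord r ∧ s ≠ 0 := by
  rw [isPositiveWord_iff_height, IsCut, IsRevPositiveWord]
  have e0 := height_joinWord_right l s r 0
  rw [height_zero, add_zero, add_zero] at e0
  have hs : s ≠ 0 ↔ (s : ℤ) ≠ 0 := by clear e0; revert s; decide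
  rw [Nat.add_sub_cancel, height_joinWord_left l s r le_rfl, e0, hs]
  refine and_congr ?_ (and_congr ?_ ?_)
  · refine forall_congr' fun i => ?_
    rw [Nat.lt_succ_iff]
    refine forall_congr' fun hi => ?_
    rw [height_joinWord_left l s r hi]
  · constructor
    · intro h i hi
      have := h (a + 1 + i) (by omega) (by omega)
      rw [height_joinWord_right] at this
      omega
    · intro h i h1 h2
      obtain ⟨i, rfl⟩ := Nat.exists_eq_add_of_le h1
      rw [height_joinWord_right]
      have := h i (by omega)
      omega
  · constructor
    · intro h
      have := h (by omega) (by omega)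
      omega
    · intro h _ _
      omega

theorem card_isCut_height {m : ℕ} (w : Fin m → SignType) [DecidablePred (IsCut (height w) m)] :
    #{j ∈ range (m + 2) | IsCut (height w) m j} = 2 := by
  classical
  convert card_isCut (height w) m fun i hi => ?_
  have := height_succ w ⟨i, hi⟩
  simp only at this
  rw [this, add_sub_cancel_left]
  exact abs_coe_signType_le_one _

/-- Splitting a word at a given letter. -/
def joinWordEquiv (a b : ℕ) :
    ((Fin a → SignType) × SignType × (Fin b → SignType)) ≃ (Fin (a + 1 + b) → SignType) where
  toFun x := joinWord x.1 x.2.1 x.2.2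
  invFun w := (fun i => w (Fin.castAdd b i.castSucc), w (Fin.castAdd b (Fin.last a)),
    fun i => w (Fin.natAdd (a + 1) i))
  left_inv x := by simp
  right_inv w := by
    funext i
    induction i using Fin.addCases with
    | left i =>
      induction i using Fin.lastCases with
      | last => simp
      | cast i => simp
    | right i => simp

/-! ### The quadratic identity -/

open Polynomial

open scoped Classical in
/-- The polynomial counting the well-labelled positive paths with `m` steps by their number of
horizontal steps. -/
noncomputable def positivePoly (m : ℕ) : ℚ[X] :=
  ∑ w : Fin m → SignType, if IsPositiveWord w then wordWeight w else 0

open scoped Classical in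
theorem sum_isRevPositiveWord (m : ℕ) :
    ∑ w : Fin m → SignType, (if IsRevPositiveWord w then wordWeight w else 0) =
      positivePoly m := by
  rw [positivePoly, ← Equiv.sum_comp (Function.Involutive.toPerm revWord (revWord_involutive m))]
  refine sum_congr rfl fun w _ => ?_
  rw [Function.Involutive.coe_toPerm, ← isPositiveWord_revWord_iff, revWord_involutive m w,
    wordWeight_revWord]

-- Reversal turns the left part into a positive word. The joining letter `0` is excluded by the cut,
-- and the letters `±1` combine through `wordWeight_joinWord_add`.
open scoped Classical in
theorem sum_isCut (a b : ℕ) :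
    ∑ w : Fin (a + 1 + b) → SignType,
      (if IsCut (height w) (a + 1 + b) (a + 1) then wordWeight w else 0) =
    ((a + 1 + (b + 1)).choose (a + 1) : ℚ[X]) * (positivePoly a * positivePoly b) := by
  rw [← (joinWordEquiv a b).sum_comp, Fintype.sum_prod_type, ← sum_isRevPositiveWord a,
    positivePoly, sum_mul_sum, mul_sum]
  refine sum_congr rfl fun l _ => ?_
  rw [Fintype.sum_prod_type_right, mul_sum]
  refine sum_congr rfl fun r _ => ?_
  have hu : (univ : Finset SignType) = {0, -1, 1} := rfl
  rw [hu, sum_insert (by decide), sum_insert (by decide), sum_singleton]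
  simp only [joinWordEquiv, Equiv.coe_fn_mk, isCut_height_joinWord_iff]
  have d1 : (-1 : SignType) ≠ 0 := by decide
  have d2 : (1 : SignType) ≠ 0 := by decide
  by_cases hl : IsRevPositiveWord l <;> by_cases hr : IsPositiveWord r <;>
    simp [hl, hr, d1, d2, ← wordWeight_joinWord_add, add_comm]

/-- `positivePoly` indexed by the size of the paths. -/
noncomputable def sizePoly : ℕ → ℚ[X]
  | 0 => 1
  | m + 1 => positivePoly m

/-- The term of index `j` is the total weight of the words with a cut at `j`. The extreme indices
are the cuts with an empty side, whence the value `1` of `sizePoly 0`. -/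
theorem sum_choose_mul_sizePoly (m : ℕ) :
    ∑ j ∈ range (m + 2), ((m + 1).choose j : ℚ[X]) * (sizePoly j * sizePoly (m + 1 - j)) =
      2 * (((m + 1)! : ℚ[X]) * (1 + X) ^ m) := by
  classical
  have h1 : ∀ j ∈ range (m + 2), ((m + 1).choose j : ℚ[X]) * (sizePoly j * sizePoly (m + 1 - j)) =
      ∑ w : Fin m → SignType, if IsCut (height w) m j then wordWeight w else 0 := by
    intro j hj
    rw [mem_range] at hj
    rcases j with _ | a
    · simp [isCut_height_zero_iff, sizePoly, positivePoly]
    rcases Nat.lt_or_ge a m with ha | ha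
    · obtain ⟨b, rfl⟩ : ∃ b, m = a + 1 + b := Nat.exists_eq_add_of_le ha
      rw [sum_isCut, show a + 1 + b + 1 - (a + 1) = b + 1 by omega]
      rfl
    · obtain rfl : a = m := by omega
      simp only [isCut_height_last_iff]
      rw [sum_isRevPositiveWord]
      simp [sizePoly]
  rw [sum_congr rfl h1, sum_comm, ← sum_wordWeight, mul_sum]
  refine sum_congr rfl fun w _ => ?_
  rw [← sum_filter, sum_const, card_isCut_height, nsmul_eq_mul, Nat.cast_two]

/-! ### Generating function and recurrence -/

/-- The exponential generating function of `sizePoly`. -/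
noncomputable def sizeSeries : PowerSeries ℚ[X] :=
  PowerSeries.mk fun n => C ((n ! : ℚ)⁻¹) * sizePoly n

theorem coeff_sizeSeries_sq (m : ℕ) :
    PowerSeries.coeff (m + 1) (sizeSeries * sizeSeries) = 2 * (1 + X) ^ m := by
  have h := sum_choose_mul_sizePoly m
  rw [PowerSeries.coeff_mul, Finset.Nat.sum_antidiagonal_eq_sum_range_succ_mk]
  have hf : C (((m + 1)! : ℚ)⁻¹) * ((m + 1)! : ℚ[X]) = 1 := by
    rw [← C_eq_natCast, ← C_mul, inv_mul_cancel₀ (by positivity), C_1]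
  calc _ = C (((m + 1)! : ℚ)⁻¹) * ∑ j ∈ range (m + 2),
        ((m + 1).choose j : ℚ[X]) * (sizePoly j * sizePoly (m + 1 - j)) := by
        rw [mul_sum]
        refine sum_congr rfl fun j hj => ?_
        rw [mem_range, Nat.lt_succ_iff] at hj
        simp only [sizeSeries, PowerSeries.coeff_mk]
        rw [← C_eq_natCast, Nat.cast_choose ℚ hj]
        have : ((j ! : ℚ)⁻¹) * (((m + 1 - j)! : ℚ)⁻¹) =
            (((m + 1)! : ℚ)⁻¹) * (((m + 1)! : ℚ) / ((j ! : ℚ) * ((m + 1 - j)! : ℚ))) := by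
          field_simp
        have := congrArg (C : ℚ → ℚ[X]) this
        rw [C_mul, C_mul] at this
        linear_combination (sizePoly j * sizePoly (m + 1 - j)) * this
    _ = _ := by rw [h]; linear_combination 2 * (1 + X) ^ m * hf

theorem coeff_zero_sizeSeries_sq : PowerSeries.coeff 0 (sizeSeries * sizeSeries) = 1 := by
  simp [PowerSeries.coeff_mul, sizeSeries, sizePoly]

theorem sizeSeries_sq :
    sizeSeries * sizeSeries * (1 - PowerSeries.C (1 + X : ℚ[X]) * PowerSeries.X) =
      1 + PowerSeries.C (1 - X : ℚ[X]) * PowerSeries.X := by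
  rw [mul_sub, mul_one, ← mul_assoc, mul_comm (sizeSeries * sizeSeries) (PowerSeries.C _)]
  ext1 n
  rw [LinearMap.map_sub, LinearMap.map_add]
  rcases n with _ | _ | n
  · simp [coeff_zero_sizeSeries_sq, PowerSeries.coeff_zero_mul_X]
  · rw [PowerSeries.coeff_succ_mul_X, PowerSeries.coeff_C_mul, coeff_sizeSeries_sq,
      coeff_zero_sizeSeries_sq, PowerSeries.coeff_succ_mul_X, PowerSeries.coeff_one]
    simp
    ring
  · rw [PowerSeries.coeff_succ_mul_X, PowerSeries.coeff_C_mul, coeff_sizeSeries_sq,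
      coeff_sizeSeries_sq, PowerSeries.coeff_succ_mul_X, PowerSeries.coeff_one,
      PowerSeries.coeff_C]
    simp
    ring

theorem sizeSeries_derivative :
    (1 + PowerSeries.C (1 - X : ℚ[X]) * PowerSeries.X) *
      (1 - PowerSeries.C (1 + X : ℚ[X]) * PowerSeries.X) *
        PowerSeries.derivative ℚ[X] sizeSeries = sizeSeries := by
  have h := sizeSeries_sq
  have hd := congrArg (PowerSeries.derivative ℚ[X]) h
  set A := sizeSeries
  simp only [Derivation.leibniz, map_add, map_sub, smul_eq_mul, Derivation.map_one_eq_zero,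
    PowerSeries.derivative_C, PowerSeries.derivative_X] at hd
  set A' := PowerSeries.derivative ℚ[X] A
  simp only [map_add, map_sub, map_one] at h hd ⊢
  set U : PowerSeries ℚ[X] := PowerSeries.C X
  set D := 1 - (1 + U) * PowerSeries.X with hD
  set N := 1 + (1 - U) * PowerSeries.X with hN
  have h0 : (2 : PowerSeries ℚ[X]) ≠ 0 := by
    intro h
    have := congrArg PowerSeries.constantCoeff h
    rw [map_ofNat, map_zero] at this
    exact two_ne_zero this
  -- Differentiating `A² D = N` and multiplying by `D` gives `2 A A' D² = (1-U) D + (1+U) N`, and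
  -- the right side is the constant `2`.
  have h2 : A * A' * D ^ 2 = 1 := by
    apply mul_left_cancel₀ h0
    linear_combination D * hd + (1 + U) * h + (1 - U) * hD + (1 + U) * hN
  linear_combination A * h2 - A' * D * h

/-- This is the coefficient of `t^(n+1)` in the differential equation, whose polynomial factor
expands to `1 - 2ut - (1-u²)t²`. -/
theorem sizePoly_succ_succ (n : ℕ) :
    sizePoly (n + 2) = (1 + 2 * (X : ℚ[X]) * (n + 1 : ℚ[X])) * sizePoly (n + 1) +
      (1 - (X : ℚ[X]) ^ 2) * ((n + 1 : ℚ[X]) * n) * sizePoly n := by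
  have h := congrArg (PowerSeries.coeff (n + 1)) sizeSeries_derivative
  have e : (1 + PowerSeries.C (1 - X : ℚ[X]) * PowerSeries.X) *
      (1 - PowerSeries.C (1 + X : ℚ[X]) * PowerSeries.X) *
        PowerSeries.derivative ℚ[X] sizeSeries =
      PowerSeries.derivative ℚ[X] sizeSeries -
      PowerSeries.C (2 * X : ℚ[X]) * (PowerSeries.derivative ℚ[X] sizeSeries * PowerSeries.X) -
      PowerSeries.C (1 - X ^ 2 : ℚ[X]) *
        (PowerSeries.derivative ℚ[X] sizeSeries * PowerSeries.X * PowerSeries.X) := by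
    simp only [map_add, map_sub, map_mul, map_one, map_pow, map_ofNat]
    ring
  rw [e, map_sub, map_sub, PowerSeries.coeff_C_mul, PowerSeries.coeff_C_mul,
    PowerSeries.coeff_succ_mul_X, PowerSeries.coeff_succ_mul_X, PowerSeries.coeff_derivative,
    PowerSeries.coeff_derivative] at h
  have h2 : PowerSeries.coeff n (PowerSeries.derivative ℚ[X] sizeSeries * PowerSeries.X) =
      n * PowerSeries.coeff n sizeSeries := by
    cases n with
    | zero => simp
    | succ n =>
      rw [PowerSeries.coeff_succ_mul_X, PowerSeries.coeff_derivative]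
      push_cast
      ring
  rw [h2] at h
  simp only [sizeSeries, PowerSeries.coeff_mk] at h
  have hC : ∀ k : ℕ, C (((k + 1)! : ℚ)⁻¹) * (k + 1 : ℚ[X]) = C ((k ! : ℚ)⁻¹) := by
    intro k
    rw [show (k + 1 : ℚ[X]) = C ((k + 1 : ℚ)) by simp, ← C_mul, Nat.factorial_succ]
    congr 1
    push_cast
    field_simp
  have h0 : C (((n + 1)! : ℚ)⁻¹) ≠ 0 := by
    rw [Ne, C_eq_zero]
    positivity
  apply mul_left_cancel₀ h0
  have hC1 := hC (n + 1)
  have hC0 := hC n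
  push_cast at hC1 h
  linear_combination h - sizePoly (n + 2) * hC1 - (1 - X ^ 2) * n * sizePoly n * hC0

/-! ### The closed form satisfies the recurrence -/

/-- The number of permutations of `m` labels that label well a positive path without horizontal
steps. -/
def ballotNumber (m : ℕ) : ℕ :=
  if Even m then ((m - 1)‼) ^ 2 else m‼ * (m - 2)‼

theorem ballotNumber_succ_succ (m : ℕ) :
    ballotNumber (m + 2) = ballotNumber (m + 1) + (m + 1) * m * ballotNumber m := by
  -- The small cases are separate because truncated subtraction reads `(-1)‼` as `0‼ = 1`.
  rcases m with _ | _ | m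
  · decide
  · decide
  rcases Nat.even_or_odd m with h | h
  · have h1 : ¬ Even (m + 1) := by simpa [Nat.even_add_one] using h
    simp only [ballotNumber, Nat.even_add_one, h, not_true, not_false_iff, if_true, if_false]
    simp only [show m + 2 + 2 - 1 = m + 1 + 2 by omega,
      show m + 2 + 1 - 2 = m + 1 by omega, show m + 2 - 1 = m + 1 by omega,
      show m + 2 + 1 = m + 1 + 2 by omega, Nat.doubleFactorial_add_two]
    ring
  · have h1 : ¬ Even m := Nat.not_even_iff_odd.2 h
    simp only [ballotNumber, Nat.even_add_one, h1, not_true, not_false_iff, if_true, if_false]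
    simp only [Nat.add_sub_cancel, show m + 1 + 1 - 2 = m from rfl,
      show m + 2 + 1 - 1 = m + 2 by omega, Nat.doubleFactorial_add_two]
    ring

/-- The number of well-labelled positive paths of size `n` with `k` horizontal steps. -/
def pathNumber (n k : ℕ) : ℚ :=
  n.choose k * (n - 1).choose k * k ! * ballotNumber (n - k)

theorem pathNumber_eq_zero {n k : ℕ} (hn : 1 ≤ n) (h : n ≤ k) : pathNumber n k = 0 := by
  simp [pathNumber, Nat.choose_eq_zero_of_lt (show n - 1 < k by omega)]

theorem pathNumber_add (k r : ℕ) : pathNumber (k + r + 1) k =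
    (k + r + 1)! * (k + r)! / ((r + 1)! * r ! * k !) * ballotNumber (r + 1) := by
  rw [pathNumber, Nat.add_sub_cancel, show k + r + 1 - k = r + 1 by omega,
    show k + r + 1 = k + (r + 1) by omega, Nat.cast_add_choose, Nat.cast_add_choose]
  field_simp

theorem pathNumber_zero_right (n : ℕ) : pathNumber n 0 = ballotNumber n := by
  simp [pathNumber]

theorem pathNumber_one_right (n : ℕ) : pathNumber (n + 1) 1 = (n + 1) * n * ballotNumber n := by
  simp [pathNumber]

theorem cast_ballotNumber_succ_succ (m : ℕ) :
    (ballotNumber (m + 2) : ℚ) = ballotNumber (m + 1) + (m + 1) * m * ballotNumber m := by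
  exact_mod_cast ballotNumber_succ_succ m

theorem pathNumber_succ_zero (n : ℕ) : pathNumber (n + 3) 0 =
    pathNumber (n + 2) 0 + (n + 2) * (n + 1) * pathNumber (n + 1) 0 := by
  have h := cast_ballotNumber_succ_succ (n + 1)
  simp only [pathNumber_zero_right]
  push_cast at h
  linear_combination h

theorem pathNumber_succ_one (n : ℕ) : pathNumber (n + 3) 1 =
    pathNumber (n + 2) 1 + 2 * (n + 2) * pathNumber (n + 2) 0 +
      (n + 2) * (n + 1) * pathNumber (n + 1) 1 := by
  have h := cast_ballotNumber_succ_succ n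
  simp only [pathNumber_zero_right, pathNumber_one_right]
  push_cast
  linear_combination (n + 2) * (n + 1) * h

theorem pathNumber_succ_add_two (n k : ℕ) : pathNumber (n + 3) (k + 2) =
    pathNumber (n + 2) (k + 2) + 2 * (n + 2) * pathNumber (n + 2) (k + 1) +
      (n + 2) * (n + 1) * (pathNumber (n + 1) (k + 2) - pathNumber (n + 1) k) := by
  have hfac : ∀ j : ℕ, ((j + 1)! : ℚ) = (j + 1) * j ! := fun j => by
    exact_mod_cast Nat.factorial_succ j
  rcases Nat.lt_or_ge n k with h | h
  · rw [pathNumber_eq_zero (by omega) (by omega), pathNumber_eq_zero (by omega) (by omega),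
      pathNumber_eq_zero (by omega) (by omega), pathNumber_eq_zero (by omega) (by omega),
      pathNumber_eq_zero (by omega) (by omega)]
    ring
  obtain ⟨r, rfl⟩ := Nat.exists_eq_add_of_le h
  rw [show k + r + 3 = k + 2 + r + 1 by omega, pathNumber_add, pathNumber_add,
    show k + r + 2 = k + 1 + r + 1 by omega, pathNumber_add]
  -- For `r = 0, 1` some terms vanish, having at least as many horizontal steps as their size, and
  -- `pathNumber_add` does not apply to them. In general the ballot recurrence eliminates
  -- `ballotNumber (r + 1)`.
  rcases r with _ | _ | r
  · rw [pathNumber_eq_zero (by omega) (by omega), pathNumber_eq_zero (by omega) (by omega)]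
    simp only [add_zero, show k + 2 = k + 1 + 1 by omega,
      hfac, zero_add]
    push_cast
    field_simp
    ring
  · rw [pathNumber_eq_zero (n := k + (0 + 1) + 1) (k := k + 2) (by omega) (by omega),
      show k + 1 + (0 + 1) + 1 = k + 2 + 0 + 1 by omega, pathNumber_add (k + 2) 0]
    have hb := cast_ballotNumber_succ_succ 0
    norm_num at hb
    simp only [show k + 2 + (0 + 1) = k + 1 + 1 + 1 by omega,
      show k + 1 + (0 + 1) = k + 1 + 1 by omega, hfac, zero_add, one_add_one_eq_two, hb]
    push_cast
    field_simp
    ring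
  · rw [show k + 1 + (r + 1 + 1) + 1 = k + 2 + (r + 1) + 1 by omega, pathNumber_add,
      show k + (r + 1 + 1) + 1 = k + 2 + r + 1 by omega, pathNumber_add]
    have hb := cast_ballotNumber_succ_succ (r + 1)
    rw [hb]
    simp only [show k + 2 + (r + 1 + 1) = k + r + 1 + 1 + 1 + 1 by omega,
      show k + 1 + (r + 1 + 1) = k + r + 1 + 1 + 1 by omega,
      show k + (r + 1 + 1) = k + r + 1 + 1 by omega,
      show k + 2 + (r + 1) = k + r + 1 + 1 + 1 by omega,
      show k + 2 + r = k + r + 1 + 1 by omega,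
      show k + 2 = k + 1 + 1 by omega, hfac]
    push_cast
    field_simp
    ring

/-! ### Coefficients and conclusion -/

theorem sizePoly_one : sizePoly 1 = 1 := by
  have h := sum_wordWeight 0
  rw [Fintype.sum_unique] at h
  rw [sizePoly, positivePoly, Fintype.sum_unique, if_pos (show IsPositiveWord _ from fun j : Fin 0 => j.elim0)]
  exact h.trans (by simp)

theorem coeff_sizePoly_succ_succ (n k : ℕ) : (sizePoly (n + 2)).coeff k =
    (sizePoly (n + 1)).coeff k + 2 * (n + 1) * (X * sizePoly (n + 1)).coeff k +
      (n + 1) * n * ((sizePoly n).coeff k - (X * (X * sizePoly n)).coeff k) := by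
  rw [sizePoly_succ_succ, show (1 + 2 * (X : ℚ[X]) * (n + 1 : ℚ[X])) * sizePoly (n + 1) +
      (1 - (X : ℚ[X]) ^ 2) * ((n + 1 : ℚ[X]) * (n : ℚ[X])) * sizePoly n =
      sizePoly (n + 1) + C (2 * (n + 1 : ℚ)) * (X * sizePoly (n + 1)) +
        C ((n + 1 : ℚ) * (n : ℚ)) * (sizePoly n - X * (X * sizePoly n)) by
    simp only [C_mul, C_add, C_1, map_natCast, map_ofNat]; ring]
  simp only [coeff_add, coeff_C_mul, coeff_sub]

theorem coeff_sizePoly (n : ℕ) : ∀ k, (sizePoly (n + 1)).coeff k = pathNumber (n + 1) k := by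
  induction n using Nat.twoStepInduction with
  | zero =>
    intro k
    rw [sizePoly_one, coeff_one]
    rcases k with _ | k
    · simp [pathNumber, ballotNumber]
    · rw [pathNumber_eq_zero le_rfl (by omega), if_neg (by omega)]
  | one =>
    intro k
    rw [coeff_sizePoly_succ_succ, sizePoly_one]
    rcases k with _ | _ | k
    · simp [pathNumber, ballotNumber]
    · simp [pathNumber, ballotNumber, coeff_one]
    · rw [pathNumber_eq_zero (by omega) (by omega)]
      simp [coeff_one, coeff_X]
  | more n ih1 ih2 =>
    intro k
    rw [coeff_sizePoly_succ_succ]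
    rcases k with _ | _ | k
    · rw [coeff_X_mul_zero, coeff_X_mul_zero, ih1, ih2, pathNumber_succ_zero]
      push_cast
      ring
    · rw [coeff_X_mul, coeff_X_mul, coeff_X_mul_zero, ih1, ih2, ih2, pathNumber_succ_one]
      push_cast
      ring
    · rw [coeff_X_mul, coeff_X_mul, coeff_X_mul, ih1, ih1, ih2, ih2, pathNumber_succ_add_two]
      push_cast
      ring

theorem coeff_positivePoly (m k : ℕ) :
    (positivePoly m).coeff k = (positivePaths (m + 1) k).ncard := by
  classical
  have hset : (positivePaths (m + 1) k).ncard =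
      #{P : (Fin m → SignType) × Perm (Fin (m + 1)) |
        IsWellLabelled (n := m + 1) P.1 P.2 ∧ IsPositiveWord P.1 ∧ horizontalSteps P.1 = k} := by
    rw [← Set.ncard_coe_finset, coe_filter_univ]
    rfl
  rw [hset, card_filter, Fintype.sum_prod_type, positivePoly, finsetSum_coeff, Nat.cast_sum]
  refine sum_congr rfl fun w _ => ?_
  by_cases hw : IsPositiveWord w
  · by_cases hk : horizontalSteps w = k
    · simp [hw, hk, wordWeight, numLabellings, ← C_eq_natCast, -map_natCast, coeff_C_mul]
    · simp [hw, hk, wordWeight, ← C_eq_natCast, -map_natCast, coeff_C_mul, coeff_X_pow, Ne.symm hk]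
  · simp [hw]

end

theorem mainTheorem4 (n k : ℕ) (hn : 1 ≤ n) :
    (Even ((n : ℤ) - (k : ℤ)) →
      (positivePaths n k).ncard =
        n.choose k * (n - 1).choose k * k ! * ((n - k - 1)‼) ^ 2) ∧
    (¬ Even ((n : ℤ) - (k : ℤ)) →
      (positivePaths n k).ncard =
        n.choose k * (n - 1).choose k * k ! * (n - k)‼ * (n - k - 2)‼) := by
  obtain ⟨m, rfl⟩ := Nat.exists_eq_add_of_le' hn
  have h1 : ((positivePaths (m + 1) k).ncard : ℚ) = pathNumber (m + 1) k := by
    rw [← coeff_positivePoly, ← coeff_sizePoly, sizePoly]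
  -- For `k > n` the parity of the integer `n - k` is not that of the truncated difference, but both
  -- formulas vanish.
  rcases Nat.lt_or_ge (m + 1) k with h | h
  · rw [pathNumber_eq_zero hn h.le, Nat.cast_eq_zero] at h1
    simp [h1, Nat.choose_eq_zero_of_lt h]
  have h2 : (positivePaths (m + 1) k).ncard = (m + 1).choose k * (m + 1 - 1).choose k * k ! *
      ballotNumber (m + 1 - k) := by
    rw [pathNumber] at h1
    exact_mod_cast h1
  have he : Even (((m + 1 : ℕ) : ℤ) - (k : ℤ)) ↔ Even (m + 1 - k) := by
    rw [← Nat.cast_sub h, Int.even_coe_nat]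
  rw [he, h2, ballotNumber]
  refine ⟨fun h => by rw [if_pos h], fun h => by rw [if_neg h, mul_assoc _ (_‼) (_‼)]⟩
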